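/- Consider a call centre with $k$ agents and $\ell\ge k$ telephone lines. Calls arrive at rate $\lambda>0$, each busy agent serves at rate $\mu>0$, and each waiting caller abandons at rate $\theta>0$. The number of callers in the system is a continuous-time Markov chain on $\{0,1,\dots,\ell\}$. In state $a$ the following events occur: an arrival at rate $\lambda$ (to $a+1$ if $a<\ell$; if $a=\ell$ the call is blocked and the state does not change), a service completion at rate $\min(a,k)\mu$ (to $a-1$), and an abandonment at rate $\max(0,a-k)\theta$ (to $a-1$). Let $\beta,\gamma\in\mathbb R$ be the costs of a blocked call and of an abandonment. For $t>0$ and initial state $a$ let $A_a(t)$ be the expected total cost of abandonments and blocked calls during $(0,t)$, let $W_a(t)$ be the expected total time that all callers together spend waiting during $(0,t)$ (that is, the expectation of $\int_0^t\max(0,X_u-k)\,du$, where $X_u$ is the state at time $u$), and let $S_a(t)$ be the expected number of services completed during $(0,t)$. Write $\tilde f(s)=\int_0^\infty e^{-st}f(t)\,dt$ for the Laplace transform, and put $\tilde A_a=\tilde W_a=\tilde S_a=0$ for $a\notin\{0,\dots,\ell\}$. Almost surely only finitely many events occur in bounded time, the three expectations exist and are finite, and their Laplace transforms converge absolutely for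 all $s\in\mathbb C$ with $\operatorname{Re}s>0$. For all such $s$ and all $a\in\{0,\dots,\ell\}$, with $$r_a=\lambda\mathbf 1_{a<\ell}+\min(a,k)\mu+\max(0,a-k)\theta,\qquad d_a=\min(a,k)\mu+\max(0,a-k)\theta,$$ one has $$\tilde A_a(s)=\frac{\lambda\tilde A_{a+1}(s)\mathbf 1_{a<\ell}+d_a\tilde A_{a-1}(s)+\frac{1}{s}\bigl(\max(0,a-k)\theta\gamma+\lambda\beta\mathbf 1_{a=\ell}\bigr)}{r_a+s},$$ $$\tilde W_a(s)=\frac{\lambda\tilde W_{a+1}(s)\mathbf 1_{a<\ell}+d_a\tilde W_{a-1}(s)+\frac{1}{s}\max(0,a-k)}{r_a+s},$$ $$\tilde S_a(s)=\frac{\lambda\tilde S_{a+1}(s)\mathbf 1_{a<\ell}+d_a\tilde S_{a-1}(s)+\frac{1}{s}\min(a,k)\mu}{r_a+s}.$$ If $\beta=0$, the abandonment cost and the waiting time are proportional: $A_a(t)=\theta\gamma\,W_a(t)$ for all $a\in\{0,\dots,\ell\}$ and $t>0$, and $\tilde A_a(s)=\theta\gamma\,\tilde W_a(s)$ for all integers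 $a$ and all $s$ with $\operatorname{Re}s>0$. -/

import Mathlib

open MeasureTheory ProbabilityTheory

noncomputable section

/-- Parameters of a single-skill call centre: `k` agents, `ℓ ≥ k` telephone lines, arrival rate
`lam`, service rate `mu` of a busy agent, abandonment rate `theta` of a waiting caller. -/
structure CallCentre where
  k : ℕ
  ℓ : ℕ
  k_le : k ≤ ℓ
  lam : ℝ
  mu : ℝ
  theta : ℝ
  lam_pos : 0 < lam
  mu_pos : 0 < mu
  theta_pos : 0 < theta

/-- The events that can happen: a call arrives, a service ends, a waiting caller abandons. -/
inductive CallEvent where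
  | arrival
  | service
  | abandonment
  deriving DecidableEq

instance : Fintype CallEvent where
  elems := {.arrival, .service, .abandonment}
  complete := by intro e; cases e <;> decide

instance : MeasurableSpace CallEvent := ⊤

namespace CallCentre

variable (C : CallCentre)

/-- The state space `{0, 1, …, ℓ}`: the number of callers in the system. -/
abbrev State : Type := Fin (C.ℓ + 1)

/-- The number of callers being served in state `a`. -/
def busy (a : C.State) : ℝ := min ((a : ℕ) : ℝ) (C.k : ℝ)

/-- The number of callers waiting in state `a`. -/
def waiting (a : C.State) : ℝ := max 0 (((a : ℕ) : ℝ) - (C.k : ℝ))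

/-- The rate at which each event occurs in state `a`. -/
def rate (a : C.State) : CallEvent → ℝ
  | .arrival => C.lam
  | .service => C.busy a * C.mu
  | .abandonment => C.waiting a * C.theta

/-- The state after an event. An arrival in state `ℓ` is blocked and leaves the state unchanged. -/
def next (a : C.State) : CallEvent → C.State
  | .arrival => if h : (a : ℕ) < C.ℓ then ⟨(a : ℕ) + 1, Nat.succ_lt_succ h⟩ else a
  | .service => ⟨(a : ℕ) - 1, lt_of_le_of_lt (Nat.sub_le _ _) a.isLt⟩
  | .abandonment => ⟨(a : ℕ) - 1, lt_of_le_of_lt (Nat.sub_le _ _) a.isLt⟩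

/-- The total rate of events (blocked arrivals included) in state `a`. -/
def totalRate (a : C.State) : ℝ := ∑ e, C.rate a e

theorem rate_nonneg (a : C.State) (e : CallEvent) : 0 ≤ C.rate a e := by
  cases e
  · exact C.lam_pos.le
  · exact mul_nonneg (le_min (Nat.cast_nonneg _) (Nat.cast_nonneg _)) C.mu_pos.le
  · exact mul_nonneg (le_max_left _ _) C.theta_pos.le

theorem totalRate_pos (a : C.State) : 0 < C.totalRate a :=
  lt_of_lt_of_le C.lam_pos
    (Finset.single_le_sum (f := C.rate a) (fun e _ => C.rate_nonneg a e)
      (Finset.mem_univ CallEvent.arrival))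

/-- In state `a`, the next event is `e` with probability `rate a e / totalRate a`. -/
def eventPMF (a : C.State) : PMF CallEvent :=
  PMF.ofFintype (fun e => ENNReal.ofReal (C.rate a e / C.totalRate a)) (by
    rw [← ENNReal.ofReal_sum_of_nonneg
      (fun e _ => div_nonneg (C.rate_nonneg a e) (C.totalRate_pos a).le), ← Finset.sum_div]
    change ENNReal.ofReal (C.totalRate a / C.totalRate a) = 1
    rw [div_self (C.totalRate_pos a).ne', ENNReal.ofReal_one])

/-- The joint law, in state `a`, of the time until the next event and of that event: the time is
exponential with rate `totalRate a` and independent of the event. -/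
def stepLaw (a : C.State) : Measure (ℝ × CallEvent) :=
  (expMeasure (C.totalRate a)).prod (C.eventPMF a).toMeasure

instance (a : C.State) : IsProbabilityMeasure (C.stepLaw a) := by
  have := isProbabilityMeasure_expMeasure (C.totalRate_pos a)
  unfold stepLaw
  infer_instance

/-- Sample space: `ω n x` is the pair (holding time, event) that is used in the `n`-th step of the
chain if the chain is then in state `x`. -/
abbrev Sample : Type := ℕ → C.State → ℝ × CallEvent

/-- All the pairs `ω n x` are independent, and `ω n x` has law `stepLaw x`. Hence, conditionally on
the first `n` steps, the `n`-th holding time and event have law `stepLaw x`, with `x` the current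
state: this is the jump chain and holding time construction of the continuous-time Markov chain. -/
def prob : Measure C.Sample :=
  Measure.infinitePi (fun _ : ℕ => Measure.pi (fun x : C.State => C.stepLaw x))

variable {C}

/-- The state just before the `n`-th event (`n = 0, 1, …`), when the chain starts in state `a`. -/
def chain (a : C.State) (ω : C.Sample) : ℕ → C.State
  | 0 => a
  | n + 1 => C.next (chain a ω n) (ω n (chain a ω n)).2

/-- The `n`-th event. -/
def event (a : C.State) (ω : C.Sample) (n : ℕ) : CallEvent := (ω n (chain a ω n)).2

/-- The time of the `n`-th event. -/
def eventTime (a : C.State) (ω : C.Sample) (n : ℕ) : ℝ :=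
  ∑ i ∈ Finset.range (n + 1), (ω i (chain a ω i)).1

/-- The state at time `u`, the state after all the events that happen up to time `u`. -/
def stateAt (a : C.State) (ω : C.Sample) (u : ℝ) : C.State :=
  chain a ω (Set.ncard {n : ℕ | eventTime a ω n ≤ u})

open Classical in
/-- The sum of `c x e` over all the events `e` that happen during `(0, t)`, where `x` is the state
just before the event. -/
def eventSum (c : C.State → CallEvent → ℝ) (a : C.State) (t : ℝ) (ω : C.Sample) : ℝ :=
  ∑' n : ℕ, if eventTime a ω n ∈ Set.Ioo 0 t then c (chain a ω n) (event a ω n) else 0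

/-- Cost of an event: `γ` for an abandonment, `β` for an arrival that finds all lines busy. -/
def eventCost (β γ : ℝ) (x : C.State) : CallEvent → ℝ
  | .arrival => if (x : ℕ) = C.ℓ then β else 0
  | .service => 0
  | .abandonment => γ

/-- `1` for a service, `0` for every other event. -/
def serviceCount (_ : C.State) : CallEvent → ℝ
  | .arrival => 0
  | .service => 1
  | .abandonment => 0

/-- The cost of abandonments and losses during `(0, t)`. -/
def cost (β γ : ℝ) (a : C.State) (t : ℝ) (ω : C.Sample) : ℝ := eventSum (eventCost β γ) a t ω

/-- The number of services during `(0, t)`. -/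
def services (a : C.State) (t : ℝ) (ω : C.Sample) : ℝ := eventSum serviceCount a t ω

/-- The total time that all the callers together spend waiting during `(0, t)`. -/
def waitingTime (a : C.State) (t : ℝ) (ω : C.Sample) : ℝ :=
  ∫ u in Set.Ioo 0 t, C.waiting (stateAt a ω u)

/-- `A_a(t)`: the expected cost of abandonments and losses during `(0, t)` from state `a`. -/
def A (β γ : ℝ) (a : C.State) (t : ℝ) : ℝ := ∫ ω, cost β γ a t ω ∂C.prob

/-- `W_a(t)`: the expected total waiting time during `(0, t)` from state `a`. -/
def W (a : C.State) (t : ℝ) : ℝ := ∫ ω, waitingTime a t ω ∂C.prob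

/-- `S_a(t)`: the expected number of services during `(0, t)` from state `a`. -/
def S (a : C.State) (t : ℝ) : ℝ := ∫ ω, services a t ω ∂C.prob

/-- Convergence of the integral that defines the Laplace transform of `f` at `s`. -/
def LaplaceConverges (f : ℝ → ℝ) (s : ℂ) : Prop :=
  IntegrableOn (fun t : ℝ => Complex.exp (-(s * (t : ℂ))) * ((f t : ℝ) : ℂ)) (Set.Ioi 0)

/-- The Laplace transform `∫_0^∞ e^{-st} f(t) dt`. -/
def laplace (f : ℝ → ℝ) (s : ℂ) : ℂ :=
  ∫ t in Set.Ioi (0 : ℝ), Complex.exp (-(s * (t : ℂ))) * ((f t : ℝ) : ℂ)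

/-- The Laplace transform of `f a`, set to `0` for `a ∉ {0, 1, …, ℓ}`. -/
def laplaceExt (f : C.State → ℝ → ℝ) (a : ℤ) (s : ℂ) : ℂ :=
  if h : 0 ≤ a ∧ a ≤ (C.ℓ : ℤ) then laplace (f ⟨a.toNat, by omega⟩) s else 0

end CallCentre

end
/-!
If `τ` is exponential with rate `r`, then `E[f τ] = r E[∫₀^τ f]`. Each step of the chain is
independent of the past, so the expectation of `c (xₙ, eₙ) f (Tₙ₊₁)`, where `Tₙ₊₁` is the time of
the event `eₙ` in state `xₙ`, is the expectation of `g (xₙ) ∫_{Tₙ}^{Tₙ₊₁} f`, with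
`g x = ∑ₑ rate x e * c x e`. Summed over `n` against `f = 1_{(0,t)}`, this rules out infinitely many
events in bounded time, and it turns an expected sum over events into the time integral of
`E[g (X_u)] f u`.

With `f = 1_{(0,t)}`, the three functions `A`, `W` and `S` are all of the form `∫₀ᵗ E[g (X_u)] du`.
For `β = 0` the function `g` of `A` is `θγ` times that of `W`, whence the proportionality.

With `f u = e^{-su}` and `c x e = h (next x e) - h x`, the sum over events telescopes and gives
`R (G h) = s R h - h`, where `G` is the generator and `R h = ∫₀^∞ e^{-su} E[h (X_u)] du`. So
`R (s - G) = 1`. The state space is finite, hence also `(s - G) R = 1`: this is the linear system,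
up to the factor `1 / s` that the time integral contributes to the Laplace transform.
-/

noncomputable section

open Set Filter Topology

theorem indepFun_eval_of_dependsOn {ι Y : Type*} {X : ι → Type*} [∀ i, MeasurableSpace (X i)]
    [MeasurableSpace Y] {μ : ∀ i, Measure (X i)} [∀ i, IsProbabilityMeasure (μ i)]
    {f : (∀ i, X i) → Y} (hf : Measurable f) {s : Finset ι} (hs : DependsOn f s) {i : ι}
    (hi : i ∉ s) : IndepFun f (fun ω => ω i) (Measure.infinitePi μ) := by
  classical
  have x₀ : ∀ j, X j := fun j => (nonempty_of_isProbabilityMeasure (μ j)).some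
  have hindep := (iIndepFun_infinitePi (P := μ) fun _ => measurable_id).indepFun_finset s {i}
    (Finset.disjoint_singleton_right.2 hi) fun j => measurable_pi_apply j
  let extend : (∀ j : s, X j) → ∀ j, X j := fun y j => if h : j ∈ s then y ⟨j, h⟩ else x₀ j
  have hextend : Measurable extend := measurable_pi_lambda _ fun j => by
    by_cases h : j ∈ s
    · simpa only [extend, h, dite_true] using measurable_pi_apply _
    · simpa only [extend, h, dite_false] using measurable_const
  have hfactor : f = (f ∘ extend) ∘ s.restrict :=
    funext fun ω => hs fun j hj => by simp [extend, Finset.mem_coe.1 hj]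
  rw [hfactor]
  exact hindep.comp (hf.comp hextend)
    (measurable_pi_apply (⟨i, Finset.mem_singleton_self i⟩ : ({i} : Finset ι)))

section Series

variable {Ω E : Type*} {mΩ : MeasurableSpace Ω} {μ : Measure Ω} [NormedAddCommGroup E]
  {F : ℕ → Ω → E}

theorem tsum_lintegral_enorm_ne_top (hF : ∀ n, Integrable (F n) μ)
    (hsum : Summable fun n => ∫ ω, ‖F n ω‖ ∂μ) : ∑' n, ∫⁻ ω, ‖F n ω‖ₑ ∂μ ≠ ⊤ := by
  simp_rw [← fun n => ofReal_integral_norm_eq_lintegral_enorm (hF n)]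
  exact hsum.tsum_ofReal_ne_top

theorem ae_summable_norm_of_summable_integral_norm (hF : ∀ n, Integrable (F n) μ)
    (hsum : Summable fun n => ∫ ω, ‖F n ω‖ ∂μ) : ∀ᵐ ω ∂μ, Summable fun n => ‖F n ω‖ := by
  refine summable_norm_of_tsum_eLpNorm_ne_top le_rfl (fun n => (hF n).1) ?_
  simpa only [eLpNorm_one_eq_lintegral_enorm] using tsum_lintegral_enorm_ne_top hF hsum

theorem integrable_tsum_of_summable_integral_norm [CompleteSpace E]
    (hF : ∀ n, Integrable (F n) μ) (hsum : Summable fun n => ∫ ω, ‖F n ω‖ ∂μ) :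
    Integrable (fun ω => ∑' n, F n ω) μ := by
  have hsummable := ae_summable_norm_of_summable_integral_norm hF hsum
  refine ⟨aestronglyMeasurable_of_tendsto_ae atTop
    (fun N => (integrable_finsetSum (Finset.range N) fun n _ => hF n).1) ?_, ?_⟩
  · filter_upwards [hsummable] with ω hω using hω.of_norm.hasSum.tendsto_sum_nat
  · calc ∫⁻ ω, ‖∑' n, F n ω‖ₑ ∂μ ≤ ∫⁻ ω, ∑' n, ‖F n ω‖ₑ ∂μ :=
          lintegral_mono fun ω => enorm_tsum_le_tsum_enorm
      _ = ∑' n, ∫⁻ ω, ‖F n ω‖ₑ ∂μ := lintegral_tsum fun n => (hF n).1.enorm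
      _ < ⊤ := (tsum_lintegral_enorm_ne_top hF hsum).lt_top

end Series

section Exponential

theorem expMeasure_eq_withDensity (r : ℝ) :
    expMeasure r = (volume.restrict (Ioi 0)).withDensity
      (fun x => ENNReal.ofReal (r * Real.exp (-(r * x)))) := by
  change volume.withDensity (exponentialPDF r) = _
  rw [Measure.restrict_congr_set (Ioi_ae_eq_Ici (a := (0 : ℝ))),
    ← withDensity_indicator measurableSet_Ici]
  congr 1 with x
  by_cases hx : 0 ≤ x <;> simp [exponentialPDF_eq, hx]

theorem ae_pos_expMeasure (r : ℝ) : ∀ᵐ x ∂expMeasure r, 0 < x := by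
  rw [expMeasure_eq_withDensity]
  exact (withDensity_absolutelyContinuous _ _).ae_le (ae_restrict_mem measurableSet_Ioi)

variable {r : ℝ} {E : Type*} [NormedAddCommGroup E] [NormedSpace ℝ E]

theorem integral_expMeasure (hr : 0 < r) (f : ℝ → E) :
    ∫ x, f x ∂expMeasure r = ∫ x in Ioi 0, (r * Real.exp (-(r * x))) • f x := by
  rw [expMeasure_eq_withDensity, integral_withDensity_eq_integral_toReal_smul (by fun_prop)
    (by simp)]
  simp_rw [ENNReal.toReal_ofReal (show 0 ≤ r * Real.exp _ by positivity)]

theorem expMeasure_real_Ici (hr : 0 < r) {u : ℝ} (hu : 0 ≤ u) :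
    (expMeasure r).real (Ici u) = Real.exp (-(r * u)) := by
  have := isProbabilityMeasure_expMeasure hr
  have hac : expMeasure r ≪ volume := withDensity_absolutelyContinuous _ _
  rw [← measureReal_congr (hac.ae_le Ioi_ae_eq_Ici), ← Set.compl_Iic,
    probReal_compl_eq_one_sub measurableSet_Iic, ← cdf_eq_real, cdf_expMeasure_eq hr, if_pos hu,
    sub_sub_cancel]

theorem integral_expMeasure_eq_smul_integral_primitive [CompleteSpace E] (hr : 0 < r) {f : ℝ → E}
    (hf : IntegrableOn f (Ioi 0)) :
    ∫ τ, f τ ∂expMeasure r = r • ∫ τ, (∫ u in 0..τ, f u) ∂expMeasure r := by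
  have := isProbabilityMeasure_expMeasure hr
  have hprim : ∀ᵐ τ ∂expMeasure r, ∫ u in 0..τ, f u =
      ∫ u in Ioi 0, (Ici u).indicator (fun _ => f u) τ := by
    filter_upwards [ae_pos_expMeasure r] with τ hτ
    have hslice (u : ℝ) : (Ici u).indicator (fun _ => f u) τ = (Iic τ).indicator f u := by
      simp [indicator]
    simp_rw [hslice]
    rw [setIntegral_indicator measurableSet_Iic, Ioi_inter_Iic,
      intervalIntegral.integral_of_le hτ.le]
  have hintegrable : Integrable (Function.uncurry fun τ u => (Ici u).indicator (fun _ => f u) τ)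
      ((expMeasure r).prod (volume.restrict (Ioi 0))) :=
    (hf.comp_snd _).indicator (measurableSet_le measurable_snd measurable_fst)
  rw [integral_congr_ae hprim, integral_integral_swap hintegrable, integral_expMeasure hr,
    ← integral_smul]
  refine setIntegral_congr_fun measurableSet_Ioi fun u hu => ?_
  rw [integral_indicator_const _ measurableSet_Ici, expMeasure_real_Ici hr (le_of_lt hu), mul_smul]

end Exponential

section Integrals

theorem exists_norm_le {ι E : Type*} [Finite ι] [NormedAddCommGroup E] (f : ι → E) :
    ∃ K, ∀ i, ‖f i‖ ≤ K := by
  obtain ⟨K, hK⟩ := (finite_range fun i => ‖f i‖).bddAbove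
  exact ⟨K, fun i => hK ⟨i, rfl⟩⟩

section Interval

variable {E : Type*} [NormedAddCommGroup E] [NormedSpace ℝ E] {f : ℝ → E}

theorem continuous_integral_endpoints (hf : Integrable f) :
    Continuous fun p : ℝ × ℝ => ∫ u in p.1..p.2, f u := by
  have hprim : Continuous fun b => ∫ u in (0 : ℝ)..b, f u :=
    intervalIntegral.continuous_primitive (fun _ _ => hf.intervalIntegrable) 0
  simp_rw [← fun p : ℝ × ℝ => intervalIntegral.integral_interval_sub_left
    (hf.intervalIntegrable (a := 0) (b := p.2)) (hf.intervalIntegrable (a := 0) (b := p.1))]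
  exact (hprim.comp continuous_snd).sub (hprim.comp continuous_fst)

theorem norm_intervalIntegral_le (hf : Integrable f) (a b : ℝ) :
    ‖∫ u in a..b, f u‖ ≤ ∫ u, ‖f u‖ :=
  intervalIntegral.norm_integral_le_integral_norm_uIoc.trans
    (setIntegral_le_integral hf.norm (Eventually.of_forall fun _ => norm_nonneg _))

end Interval

theorem measurable_indicator_Ioo (t : ℝ) : Measurable ((Ioo 0 t).indicator (1 : ℝ → ℝ)) :=
  measurable_one.indicator measurableSet_Ioo

theorem integrable_indicator_Ioo (t : ℝ) : Integrable ((Ioo 0 t).indicator (1 : ℝ → ℝ)) :=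
  (integrable_indicator_iff measurableSet_Ioo).2 (integrableOn_const measure_Ioo_lt_top.ne)

theorem norm_indicator_Ioo_le (t u : ℝ) : ‖(Ioo 0 t).indicator (1 : ℝ → ℝ) u‖ ≤ 1 :=
  (norm_indicator_le_norm_self 1 u).trans_eq norm_one

variable {s : ℂ}

theorem integrableOn_exp_neg_mul (hs : 0 < s.re) :
    IntegrableOn (fun t : ℝ => Complex.exp (-(s * t))) (Ioi 0) := by
  simpa only [neg_mul] using integrableOn_exp_mul_complex_Ioi (a := -s) (by simpa using hs) 0

theorem integral_exp_neg_mul (hs : 0 < s.re) :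
    ∫ t : ℝ in Ioi 0, Complex.exp (-(s * t)) = 1 / s := by
  simpa using integral_exp_mul_complex_Ioi (a := -s) (by simpa using hs) 0

theorem integral_exp_neg_mul_interval (hs : s ≠ 0) (b c : ℝ) :
    s * ∫ u : ℝ in b..c, Complex.exp (-(s * u)) =
      Complex.exp (-(s * b)) - Complex.exp (-(s * c)) := by
  simp_rw [← neg_mul]
  rw [integral_exp_mul_complex (neg_ne_zero.2 hs)]
  field_simp
  ring

/-- The function `e^{-su}` on `(0, ∞)`, extended by `0` to an integrable function on the line. -/
def expKernel (s : ℂ) : ℝ → ℂ := (Ioi 0).indicator fun u => Complex.exp (-(s * u))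

theorem expKernel_of_pos {u : ℝ} (hu : 0 < u) : expKernel s u = Complex.exp (-(s * u)) :=
  indicator_of_mem hu _

theorem measurable_expKernel : Measurable (expKernel s) :=
  Measurable.indicator (by fun_prop) measurableSet_Ioi

theorem integrable_expKernel (hs : 0 < s.re) : Integrable (expKernel s) :=
  (integrable_indicator_iff measurableSet_Ioi).2 (integrableOn_exp_neg_mul hs)

theorem norm_expKernel_le (hs : 0 < s.re) (u : ℝ) : ‖expKernel s u‖ ≤ 1 := by
  rcases le_or_gt u 0 with hu | hu
  · simp [expKernel, hu]
  · rw [expKernel_of_pos hu, Complex.norm_exp]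
    simpa using mul_nonneg hs.le hu.le

theorem setIntegral_mul_expKernel (φ : ℝ → ℂ) :
    ∫ u in Ioi 0, φ u * expKernel s u =
      ∫ u : ℝ in Ioi 0, φ u * Complex.exp (-(s * u)) :=
  setIntegral_congr_fun measurableSet_Ioi fun u hu => by rw [expKernel_of_pos hu]

theorem integral_expKernel_interval {b c : ℝ} (hb : 0 ≤ b) (hbc : b ≤ c) :
    ∫ u in b..c, expKernel s u = ∫ u : ℝ in b..c, Complex.exp (-(s * u)) := by
  simp_rw [intervalIntegral.integral_of_le hbc]
  exact setIntegral_congr_fun measurableSet_Ioc fun u hu => expKernel_of_pos (hb.trans_lt hu.1)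

end Integrals

namespace CallCentre

section Laplace

variable {f : ℝ → ℝ} {s : ℂ}

theorem laplaceConverges_of_bounded (hf : Measurable f) {K : ℝ} (hK : ∀ t, |f t| ≤ K)
    (hs : 0 < s.re) : LaplaceConverges f s :=
  (integrableOn_exp_neg_mul hs).mul_bdd (Complex.measurable_ofReal.comp hf).aestronglyMeasurable
    (Eventually.of_forall fun t => by simpa using hK t)

theorem laplace_const_mul (c : ℝ) : laplace (fun t => c * f t) s = c * laplace f s := by
  simp_rw [laplace, ← integral_const_mul, Complex.ofReal_mul, mul_left_comm (c : ℂ)]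

theorem exp_mul_primitive_eq_convolution {t : ℝ} (ht : 0 < t) :
    Complex.exp (-(s * t)) * ((∫ u in Ioo 0 t, f u : ℝ) : ℂ) =
      ∫ u in 0..t, ContinuousLinearMap.mul ℝ ℂ (Complex.exp (-(s * u)) * f u)
        (Complex.exp (-(s * (t - u : ℝ)))) := by
  rw [← integral_complex_ofReal, ← integral_const_mul, intervalIntegral.integral_of_le ht.le,
    integral_Ioc_eq_integral_Ioo]
  congr 1 with u
  rw [ContinuousLinearMap.mul_apply', mul_right_comm, ← Complex.exp_add]
  congr 2
  push_cast
  ring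

theorem LaplaceConverges.primitive (hf : LaplaceConverges f s) (hs : 0 < s.re) :
    LaplaceConverges (fun t => ∫ u in Ioo 0 t, f u) s := by
  refine ((integrable_posConvolution hf (integrableOn_exp_neg_mul hs)
    (ContinuousLinearMap.mul ℝ ℂ)).integrableOn).congr_fun (fun t ht => ?_) measurableSet_Ioi
  rw [posConvolution, indicator_of_mem ht, ← exp_mul_primitive_eq_convolution ht]

theorem laplace_primitive (hf : LaplaceConverges f s) (hs : 0 < s.re) :
    laplace (fun t => ∫ u in Ioo 0 t, f u) s = laplace f s / s := by
  rw [div_eq_mul_one_div, ← integral_exp_neg_mul hs]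
  refine (setIntegral_congr_fun measurableSet_Ioi fun t ht => ?_).trans
    (integral_posConvolution hf (integrableOn_exp_neg_mul hs) (ContinuousLinearMap.mul ℝ ℂ))
  exact exp_mul_primitive_eq_convolution ht

end Laplace

variable {C : CallCentre}

section Paths

instance : MeasurableSingletonClass CallEvent := ⟨fun _ => trivial⟩

instance : IsProbabilityMeasure C.prob := by
  unfold prob
  infer_instance

/-- The time at which the `n`-th step of the chain starts: time `0` for `n = 0`, and the time of
the event number `n - 1` for `n > 0`. -/
def startTime (a : C.State) (ω : C.Sample) (n : ℕ) : ℝ :=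
  ∑ i ∈ Finset.range n, (ω i (chain a ω i)).1

theorem startTime_zero (a : C.State) (ω : C.Sample) : startTime a ω 0 = 0 := rfl

theorem startTime_succ (a : C.State) (ω : C.Sample) (n : ℕ) :
    startTime a ω (n + 1) = startTime a ω n + (ω n (chain a ω n)).1 :=
  Finset.sum_range_succ _ _

theorem eventTime_eq_startTime_succ (a : C.State) (ω : C.Sample) (n : ℕ) :
    eventTime a ω n = startTime a ω (n + 1) := rfl

theorem ae_pos_stepLaw (x : C.State) : ∀ᵐ y ∂C.stepLaw x, 0 < y.1 := by
  have := isProbabilityMeasure_expMeasure (C.totalRate_pos x)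
  exact Measure.quasiMeasurePreserving_fst.ae (ae_pos_expMeasure (C.totalRate x))

theorem ae_strictMono_startTime (a : C.State) :
    ∀ᵐ ω ∂C.prob, StrictMono (startTime a ω) := by
  have hpos : ∀ᵐ ω ∂C.prob, ∀ n x, 0 < (ω n x).1 := by
    refine ae_all_iff.2 fun n => ae_all_iff.2 fun x => ?_
    exact ((measurePreserving_eval C.stepLaw x).comp
      (measurePreserving_eval_infinitePi _ n)).quasiMeasurePreserving.ae (ae_pos_stepLaw x)
  filter_upwards [hpos] with ω hω
  refine strictMono_nat_of_lt_succ fun n => ?_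
  rw [startTime_succ]
  exact lt_add_of_pos_right _ (hω n _)

theorem measurable_eval_state {Z : Type*} [MeasurableSpace Z] :
    Measurable fun p : C.State × (C.State → Z) => p.2 p.1 :=
  measurable_from_prod_countable_right fun x => measurable_pi_apply x

@[fun_prop]
theorem measurable_chain (a : C.State) (n : ℕ) : Measurable fun ω => chain a ω n := by
  induction n with
  | zero => exact measurable_const
  | succ n ih =>
    have hnext : Measurable fun p : C.State × CallEvent => C.next p.1 p.2 := .of_discrete
    exact hnext.comp (ih.prodMk
      (measurable_eval_state.comp (ih.prodMk (measurable_pi_apply n))).snd)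

theorem measurable_step (a : C.State) (n : ℕ) :
    Measurable fun ω : C.Sample => ω n (chain a ω n) :=
  measurable_eval_state.comp ((measurable_chain a n).prodMk (measurable_pi_apply n))

@[fun_prop]
theorem measurable_startTime (a : C.State) (n : ℕ) : Measurable fun ω => startTime a ω n :=
  Finset.measurable_fun_sum _ fun i _ => (measurable_step a i).fst

theorem measurable_stateAt (a : C.State) :
    Measurable fun p : C.Sample × ℝ => stateAt a p.1 p.2 := by
  have hcount : Measurable fun p : C.Sample × ℝ => {n | startTime a p.1 (n + 1) ≤ p.2}.ncard := by
    refine measurable_ncard.comp (measurable_set_iff.2 fun n => measurable_mem.2 ?_)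
    exact measurableSet_le ((measurable_startTime a (n + 1)).comp measurable_fst) measurable_snd
  have hchain : Measurable fun p : C.Sample × ℕ => chain a p.1 p.2 :=
    measurable_from_prod_countable_left fun n => measurable_chain a n
  exact hchain.comp (measurable_fst.prodMk hcount)

theorem stateAt_eq_chain {a : C.State} {ω : C.Sample} (hω : StrictMono (startTime a ω)) {n : ℕ}
    {u : ℝ} (hu : u ∈ Ico (startTime a ω n) (startTime a ω (n + 1))) :
    stateAt a ω u = chain a ω n := by
  have hevents : {m : ℕ | eventTime a ω m ≤ u} = Iio n := by
    ext m
    refine ⟨fun hm => ?_, fun hm => (hω.monotone (Nat.succ_le_of_lt hm)).trans hu.1⟩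
    exact Nat.lt_of_succ_lt_succ (hω.lt_iff_lt.1 (lt_of_le_of_lt hm hu.2))
  rw [stateAt, hevents, ncard_Iio_nat]

theorem chain_congr (a : C.State) (n : ℕ) {ω ω' : C.Sample} (h : ∀ i < n, ω i = ω' i) :
    chain a ω n = chain a ω' n := by
  induction n with
  | zero => rfl
  | succ n ih => rw [chain, chain, ih fun i hi => h i (hi.trans n.lt_succ_self), h n n.lt_succ_self]

theorem dependsOn_chain_startTime (a : C.State) (n : ℕ) :
    DependsOn (fun ω : C.Sample => (chain a ω n, startTime a ω n)) (Finset.range n) := by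
  intro ω ω' h
  simp only [Finset.coe_range, Set.mem_Iio] at h
  have htime : startTime a ω n = startTime a ω' n := Finset.sum_congr rfl fun i hi => by
    have hi := Finset.mem_range.1 hi
    rw [chain_congr a i fun j hj => h j (hj.trans hi), h i hi]
  exact Prod.ext (chain_congr a n h) htime

end Paths

section Compensator

theorem integral_step {E : Type*} [NormedAddCommGroup E] [NormedSpace ℝ E] (a : C.State) (n : ℕ)
    {H : C.State × ℝ → ℝ × CallEvent → E} (hH : StronglyMeasurable (Function.uncurry H))
    (hintegrable : Integrable (fun ω => H (chain a ω n, startTime a ω n) (ω n (chain a ω n))) C.prob) :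
    ∫ ω, H (chain a ω n, startTime a ω n) (ω n (chain a ω n)) ∂C.prob =
      ∫ ω, ∫ y, H (chain a ω n, startTime a ω n) y ∂C.stepLaw (chain a ω n) ∂C.prob := by
  let past : C.Sample → C.State × ℝ := fun ω => (chain a ω n, startTime a ω n)
  let G : (C.State × ℝ) × (C.State → ℝ × CallEvent) → E := fun p => H p.1 (p.2 p.1.1)
  have hpast : Measurable past := by fun_prop
  have hcoord : Measurable fun ω : C.Sample => ω n := measurable_pi_apply n
  have hG : StronglyMeasurable G := hH.comp_measurable (measurable_fst.prodMk
    (measurable_eval_state.comp (measurable_fst.fst.prodMk measurable_snd)))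
  have hlaw : C.prob.map (fun ω => (past ω, ω n)) =
      (C.prob.map past).prod (Measure.pi C.stepLaw) := by
    have hindep : IndepFun past (fun ω => ω n) C.prob := indepFun_eval_of_dependsOn hpast
      (dependsOn_chain_startTime a n) Finset.notMem_range_self
    rw [(indepFun_iff_map_prod_eq_prod_map_map hpast.aemeasurable hcoord.aemeasurable).1 hindep]
    congr 1
    exact (measurePreserving_eval_infinitePi _ n).map_eq
  have hGint : Integrable G ((C.prob.map past).prod (Measure.pi C.stepLaw)) := by
    rw [← hlaw]
    exact (integrable_map_measure hG.aestronglyMeasurable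
      (hpast.prodMk hcoord).aemeasurable).2 hintegrable
  calc ∫ ω, G (past ω, ω n) ∂C.prob
      = ∫ p, G p ∂(C.prob.map past).prod (Measure.pi C.stepLaw) := by
        rw [← hlaw, integral_map (hpast.prodMk hcoord).aemeasurable hG.aestronglyMeasurable]
    _ = ∫ ω, ∫ z, G (past ω, z) ∂Measure.pi C.stepLaw ∂C.prob := by
        rw [integral_prod _ hGint, integral_map hpast.aemeasurable
          hG.integral_prod_right.aestronglyMeasurable]
    _ = ∫ ω, ∫ y, H (past ω) y ∂C.stepLaw (chain a ω n) ∂C.prob := by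
        congr 1 with ω
        rw [← (measurePreserving_eval C.stepLaw (chain a ω n)).map_eq, integral_map
          (measurable_pi_apply _).aemeasurable
          (hH.comp_measurable measurable_prodMk_left).aestronglyMeasurable]

variable {𝕜 : Type*} [RCLike 𝕜]

theorem integral_stepLaw_mul (x : C.State) (f : ℝ → 𝕜) (g : CallEvent → 𝕜) :
    ∫ y, f y.1 * g y.2 ∂C.stepLaw x = (∫ τ, f τ ∂expMeasure (C.totalRate x)) *
      ∑ e, ((C.rate x e / C.totalRate x : ℝ) : 𝕜) * g e := by
  have := isProbabilityMeasure_expMeasure (C.totalRate_pos x)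
  rw [stepLaw, integral_prod_mul, PMF.integral_eq_sum]
  congr 1
  refine Finset.sum_congr rfl fun e _ => ?_
  rw [eventPMF, PMF.ofFintype_apply,
    ENNReal.toReal_ofReal (div_nonneg (C.rate_nonneg x e) (C.totalRate_pos x).le),
    RCLike.real_smul_eq_coe_mul]

/-- The rate at which rewards accrue in state `x`, when an event `e` in state `x` is rewarded with
`c x e`. -/
def rewardRate (c : C.State → CallEvent → 𝕜) (x : C.State) : 𝕜 := ∑ e, (C.rate x e : 𝕜) * c x e

theorem integral_stepLaw_event (c : C.State → CallEvent → 𝕜) {f : ℝ → 𝕜} (hf : Integrable f)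
    (x : C.State) (t : ℝ) :
    ∫ y, c x y.2 * f (t + y.1) ∂C.stepLaw x =
      ∫ y, (rewardRate c x * ∫ u in t..t + y.1, f u) ∂C.stepLaw x := by
  have := isProbabilityMeasure_expMeasure (C.totalRate_pos x)
  have hr : (C.totalRate x : 𝕜) ≠ 0 := RCLike.ofReal_ne_zero.2 (C.totalRate_pos x).ne'
  have hrate : (C.totalRate x : 𝕜) * ∑ e, ((C.rate x e / C.totalRate x : ℝ) : 𝕜) * c x e =
      rewardRate c x := by
    simp_rw [rewardRate, Finset.mul_sum, RCLike.ofReal_div, ← mul_assoc, mul_div_cancel₀ _ hr]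
  simp_rw [mul_comm (c x _)]
  rw [integral_stepLaw_mul x fun τ => f (t + τ), integral_expMeasure_eq_smul_integral_primitive
    (C.totalRate_pos x) (hf.comp_add_left t).integrableOn, RCLike.real_smul_eq_coe_mul,
    mul_right_comm, hrate, integral_const_mul, stepLaw,
    integral_fun_fst (fun τ => ∫ u in t..t + τ, f u)]
  simp [intervalIntegral.integral_comp_add_left]

variable (c : C.State → CallEvent → 𝕜) (g : C.State → 𝕜) {f : ℝ → 𝕜} (a : C.State)

theorem integrable_event_mul (hf : Measurable f) {K : ℝ} (hK : ∀ u, ‖f u‖ ≤ K) (n : ℕ) :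
    Integrable (fun ω => c (chain a ω n) (event a ω n) * f (eventTime a ω n)) C.prob := by
  obtain ⟨M, hM⟩ := exists_norm_le (Function.uncurry c)
  have hc : Measurable (Function.uncurry c) := .of_discrete
  refine Integrable.of_bound (C := M * K) ?_ (Eventually.of_forall fun ω => ?_)
  · exact ((hc.comp ((measurable_chain a n).prodMk (measurable_step a n).snd)).mul
      (hf.comp (measurable_startTime a (n + 1)))).aestronglyMeasurable
  · exact norm_mul_le_of_le (hM (chain a ω n, event a ω n)) (hK _)

theorem integrable_mul_integral_startTime (hf : Integrable f) (n : ℕ) :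
    Integrable (fun ω => g (chain a ω n) * ∫ u in startTime a ω n..startTime a ω (n + 1), f u)
      C.prob := by
  obtain ⟨M, hM⟩ := exists_norm_le g
  have hg : Measurable g := .of_discrete
  refine Integrable.of_bound (C := M * ∫ u, ‖f u‖) ?_ (Eventually.of_forall fun ω => ?_)
  · exact ((hg.comp (measurable_chain a n)).mul ((continuous_integral_endpoints hf).measurable.comp
      ((measurable_startTime a n).prodMk (measurable_startTime a (n + 1))))).aestronglyMeasurable
  · exact norm_mul_le_of_le (hM _) (norm_intervalIntegral_le hf _ _)

theorem integral_event_mul_eq_integral_rewardRate_mul (hf : Measurable f) (hfi : Integrable f)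
    {K : ℝ} (hK : ∀ u, ‖f u‖ ≤ K) (n : ℕ) :
    ∫ ω, c (chain a ω n) (event a ω n) * f (eventTime a ω n) ∂C.prob =
      ∫ ω, (rewardRate c (chain a ω n) *
        ∫ u in startTime a ω n..startTime a ω (n + 1), f u) ∂C.prob := by
  let reward (p : C.State × ℝ) (y : ℝ × CallEvent) : 𝕜 := c p.1 y.2 * f (p.2 + y.1)
  let compensator (p : C.State × ℝ) (y : ℝ × CallEvent) : 𝕜 :=
    rewardRate c p.1 * ∫ u in p.2..p.2 + y.1, f u
  have hc : Measurable (Function.uncurry c) := .of_discrete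
  have hr : Measurable (rewardRate c) := .of_discrete
  have hreward : Measurable (Function.uncurry reward) :=
    (hc.comp (measurable_fst.fst.prodMk measurable_snd.snd)).mul
      (hf.comp (measurable_fst.snd.add measurable_snd.fst))
  have hcompensator : Measurable (Function.uncurry compensator) :=
    (hr.comp measurable_fst.fst).mul ((continuous_integral_endpoints hfi).measurable.comp
      (measurable_fst.snd.prodMk (measurable_fst.snd.add measurable_snd.fst)))
  have hreward_int := integrable_event_mul c a hf hK n
  have hcompensator_int := integrable_mul_integral_startTime (rewardRate c) a hfi n
  simp_rw [eventTime_eq_startTime_succ, startTime_succ] at hreward_int hcompensator_int ⊢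
  exact (integral_step a n hreward.stronglyMeasurable hreward_int).trans (.trans
    (by simp_rw [reward, compensator, integral_stepLaw_event c hfi])
    (integral_step a n hcompensator.stronglyMeasurable hcompensator_int).symm)

theorem summable_integral_startTime {φ : ℝ → ℝ} (hφ : Integrable φ) (hφ₀ : ∀ u, 0 ≤ φ u) :
    Summable fun n => ∫ ω, (∫ u in startTime a ω n..startTime a ω (n + 1), φ u) ∂C.prob := by
  refine summable_of_sum_range_le (c := ∫ u, φ u) (fun n => ?_) fun N => ?_
  · refine integral_nonneg_of_ae ?_
    filter_upwards [ae_strictMono_startTime a] with ω hω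
    exact intervalIntegral.integral_nonneg (hω.monotone n.le_succ) fun u _ => hφ₀ u
  · have hintegrable (n : ℕ) := integrable_mul_integral_startTime (C := C) (fun _ => (1 : ℝ)) a hφ n
    simp_rw [one_mul] at hintegrable
    rw [← integral_finsetSum _ fun n _ => hintegrable n]
    simp_rw [intervalIntegral.sum_integral_adjacent_intervals fun _ _ => hφ.intervalIntegrable]
    refine (integral_mono_of_nonneg ?_ (integrable_const (∫ u, φ u)) ?_).trans_eq (by simp)
    · filter_upwards [ae_strictMono_startTime a] with ω hω
      exact intervalIntegral.integral_nonneg (hω.monotone N.zero_le) fun u _ => hφ₀ u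
    · refine Eventually.of_forall fun ω => (Real.le_norm_self _).trans ?_
      simpa only [Real.norm_of_nonneg (hφ₀ _)] using norm_intervalIntegral_le hφ _ _

theorem summable_integral_norm_mul_integral_startTime (hf : Integrable f) :
    Summable fun n => ∫ ω, ‖g (chain a ω n) *
      ∫ u in startTime a ω n..startTime a ω (n + 1), f u‖ ∂C.prob := by
  obtain ⟨M, hM⟩ := exists_norm_le g
  refine .of_nonneg_of_le (fun n => integral_nonneg fun ω => norm_nonneg _) (fun n => ?_)
    ((summable_integral_startTime a hf.norm fun u => norm_nonneg _).mul_left M)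
  rw [← integral_const_mul]
  refine integral_mono_ae (integrable_mul_integral_startTime g a hf n).norm
    (integrable_mul_integral_startTime (fun _ => M) a hf.norm n) ?_
  filter_upwards [ae_strictMono_startTime a] with ω hω
  exact norm_mul_le_of_le (hM _)
    (intervalIntegral.norm_integral_le_integral_norm (hω.monotone n.le_succ))

theorem summable_integral_norm_event_mul (hf : Measurable f) (hfi : Integrable f) {K : ℝ}
    (hK : ∀ u, ‖f u‖ ≤ K) :
    Summable fun n =>
      ∫ ω, ‖c (chain a ω n) (event a ω n) * f (eventTime a ω n)‖ ∂C.prob := by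
  simp_rw [norm_mul, fun n => integral_event_mul_eq_integral_rewardRate_mul
    (fun x e => ‖c x e‖) a hf.norm hfi.norm (by simpa using hK) n]
  exact (summable_integral_norm_mul_integral_startTime _ a hfi.norm).of_norm_bounded
    fun n => norm_integral_le_integral_norm _

end Compensator

section Explosion

variable (a : C.State)

theorem ae_finite_eventTime_le (t : ℝ) : ∀ᵐ ω ∂C.prob, {n : ℕ | eventTime a ω n ≤ t}.Finite := by
  have hmeas := measurable_indicator_Ioo (t + 1)
  have hbound := norm_indicator_Ioo_le (t + 1)
  have hsummable := ae_summable_norm_of_summable_integral_norm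
    (integrable_event_mul (fun _ _ => 1) a hmeas hbound)
    (summable_integral_norm_event_mul (fun _ _ => 1) a hmeas (integrable_indicator_Ioo _) hbound)
  filter_upwards [hsummable, ae_strictMono_startTime a] with ω hω hmono
  have hlt := hω.tendsto_cofinite_zero.eventually_lt_const one_pos
  refine (eventually_cofinite.1 hlt).subset fun n hn => ?_
  have hmem : eventTime a ω n ∈ Ioo 0 (t + 1) := 
    ⟨hmono n.succ_pos, lt_add_of_le_of_pos hn one_pos⟩
  simp [hmem]

theorem ae_tendsto_startTime :
    ∀ᵐ ω ∂C.prob, Tendsto (startTime a ω) atTop atTop := by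
  filter_upwards [ae_all_iff.2 fun N : ℕ => ae_finite_eventTime_le a N] with ω hω
  refine (tendsto_add_atTop_iff_nat 1).1 (tendsto_atTop.2 fun b => ?_)
  obtain ⟨N, hN⟩ := exists_nat_ge b
  filter_upwards [(hω N).eventually_cofinite_notMem.filter_mono Nat.cofinite_eq_atTop.ge] with n hn
  exact hN.trans (not_le.1 hn).le

end Explosion

section Campbell

variable {𝕜 : Type*} [RCLike 𝕜] (c : C.State → CallEvent → 𝕜) (g : C.State → 𝕜) {f : ℝ → 𝕜}
  (a : C.State)

theorem integrableOn_stateAt_mul {s : Set ℝ} (hf : IntegrableOn f s) :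
    Integrable (fun p : C.Sample × ℝ => g (stateAt a p.1 p.2) * f p.2)
      (C.prob.prod (volume.restrict s)) := by
  obtain ⟨M, hM⟩ := exists_norm_le g
  have hg : Measurable g := .of_discrete
  exact (hf.comp_snd _).bdd_mul (hg.comp (measurable_stateAt a)).aestronglyMeasurable
    (Eventually.of_forall fun p => hM _)

theorem hasSum_mul_integral_startTime {ω : C.Sample} (hmono : StrictMono (startTime a ω))
    (htop : Tendsto (startTime a ω) atTop atTop) (hf : Integrable f) :
    HasSum (fun n => g (chain a ω n) * ∫ u in startTime a ω n..startTime a ω (n + 1), f u)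
      (∫ u in Ioi 0, g (stateAt a ω u) * f u) := by
  obtain ⟨M, hM⟩ := exists_norm_le g
  have hg : Measurable g := .of_discrete
  have hintegrable : Integrable fun u => g (stateAt a ω u) * f u := hf.bdd_mul
    (hg.comp ((measurable_stateAt a).comp measurable_prodMk_left)).aestronglyMeasurable
    (Eventually.of_forall fun u => hM _)
  have hstep (n : ℕ) : g (chain a ω n) * ∫ u in startTime a ω n..startTime a ω (n + 1), f u =
      ∫ u in Ioc (startTime a ω n) (startTime a ω (n + 1)), g (stateAt a ω u) * f u := by
    rw [intervalIntegral.integral_of_le (hmono.monotone n.le_succ), ← integral_const_mul,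
      integral_Ioc_eq_integral_Ioo, integral_Ioc_eq_integral_Ioo]
    refine setIntegral_congr_fun measurableSet_Ioo fun u hu => ?_
    rw [stateAt_eq_chain hmono (Ioo_subset_Ico_self hu)]
  have hcover : ⋃ n, Ioc (startTime a ω n) (startTime a ω (n + 1)) = Ioi 0 :=
    iUnion_Ioc_map_succ_eq_Ioi (fun n => hmono.monotone n.zero_le)
      (not_bddAbove_of_tendsto_atTop htop)
  simp_rw [hstep, ← hcover]
  exact hasSum_integral_iUnion (fun n => measurableSet_Ioc)
    hmono.monotone.pairwise_disjoint_on_Ioc_succ hintegrable.integrableOn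

theorem integrable_comp_stateAt (u : ℝ) : Integrable (fun ω => g (stateAt a ω u)) C.prob := by
  obtain ⟨M, hM⟩ := exists_norm_le g
  have hg : Measurable g := .of_discrete
  exact .of_bound
    (hg.comp ((measurable_stateAt a).comp measurable_prodMk_right)).aestronglyMeasurable M
    (Eventually.of_forall fun ω => hM _)

/-- The transition semigroup `P_u g (a) = E_a[g (X_u)]` of the chain. -/
def transition (g : C.State → 𝕜) (a : C.State) (u : ℝ) : 𝕜 := ∫ ω, g (stateAt a ω u) ∂C.prob

theorem measurable_transition : Measurable (transition g a) := by
  have hg : Measurable g := .of_discrete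
  exact ((hg.comp (measurable_stateAt a)).stronglyMeasurable.integral_prod_left').measurable

theorem exists_norm_transition_le : ∃ K, ∀ u, ‖transition g a u‖ ≤ K := by
  obtain ⟨K, hK⟩ := exists_norm_le g
  refine ⟨K, fun u => ?_⟩
  have hle := norm_integral_le_of_norm_le_const (μ := C.prob) (f := fun ω => g (stateAt a ω u))
    (Eventually.of_forall fun ω => hK _)
  rwa [probReal_univ, mul_one] at hle

theorem integral_stateAt_mul {s : Set ℝ} (hf : IntegrableOn f s) :
    ∫ ω, (∫ u in s, g (stateAt a ω u) * f u) ∂C.prob = ∫ u in s, transition g a u * f u := by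
  rw [integral_integral_swap (integrableOn_stateAt_mul g a hf)]
  simp_rw [integral_mul_const, transition]

/-- Campbell's formula: the events form a point process with intensity `rate (X_u) e`. -/
theorem integral_tsum_event_mul (hf : Measurable f) (hfi : Integrable f) {K : ℝ}
    (hK : ∀ u, ‖f u‖ ≤ K) :
    ∫ ω, (∑' n, c (chain a ω n) (event a ω n) * f (eventTime a ω n)) ∂C.prob =
      ∫ u in Ioi 0, transition (rewardRate c) a u * f u := by
  rw [← integral_tsum_of_summable_integral_norm (integrable_event_mul c a hf hK)
    (summable_integral_norm_event_mul c a hf hfi hK)]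
  simp_rw [integral_event_mul_eq_integral_rewardRate_mul c a hf hfi hK]
  rw [integral_tsum_of_summable_integral_norm
    (integrable_mul_integral_startTime (rewardRate c) a hfi)
    (summable_integral_norm_mul_integral_startTime (rewardRate c) a hfi),
    ← integral_stateAt_mul _ a hfi.integrableOn]
  refine integral_congr_ae ?_
  filter_upwards [ae_strictMono_startTime a, ae_tendsto_startTime a] with ω hmono htop
  exact (hasSum_mul_integral_startTime _ a hmono htop hfi).tsum_eq

end Campbell

section Accrual

variable (a : C.State)

theorem transition_const_mul (r : ℝ) (g : C.State → ℝ) (u : ℝ) :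
    transition (fun x => r * g x) a u = r * transition g a u := integral_const_mul _ _

/-- The expected reward `E_a[∫₀ᵗ g (X_u) du]` that accrues at rate `g` during `(0, t)`. -/
def accrual (g : C.State → ℝ) (a : C.State) (t : ℝ) : ℝ := ∫ u in Ioo 0 t, transition g a u

theorem accrual_const_mul (r : ℝ) (g : C.State → ℝ) (t : ℝ) :
    accrual (fun x => r * g x) a t = r * accrual g a t := by
  simp_rw [accrual, transition_const_mul, integral_const_mul]

variable (c : C.State → CallEvent → ℝ) (t : ℝ)

theorem eventSum_eq_tsum_mul (ω : C.Sample) : eventSum c a t ω =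
    ∑' n, c (chain a ω n) (event a ω n) * (Ioo 0 t).indicator 1 (eventTime a ω n) := by
  simp [eventSum, indicator]

theorem integrable_eventSum : Integrable (eventSum c a t) C.prob := by
  simp_rw [funext (eventSum_eq_tsum_mul a c t)]
  exact integrable_tsum_of_summable_integral_norm
    (integrable_event_mul c a (measurable_indicator_Ioo t) (norm_indicator_Ioo_le t))
    (summable_integral_norm_event_mul c a (measurable_indicator_Ioo t)
      (integrable_indicator_Ioo t) (norm_indicator_Ioo_le t))

theorem integral_eventSum : ∫ ω, eventSum c a t ω ∂C.prob = accrual (rewardRate c) a t := by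
  simp_rw [eventSum_eq_tsum_mul]
  rw [integral_tsum_event_mul c a (measurable_indicator_Ioo t) (integrable_indicator_Ioo t)
    (norm_indicator_Ioo_le t)]
  have hind (u : ℝ) : transition (rewardRate c) a u * (Ioo 0 t).indicator 1 u =
      (Ioo 0 t).indicator (transition (rewardRate c) a) u := by simp [indicator]
  simp_rw [hind]
  rw [setIntegral_indicator measurableSet_Ioo, inter_eq_right.2 Ioo_subset_Ioi_self,
    accrual]

theorem integrable_waitingTime : Integrable (waitingTime a t) C.prob := by
  change Integrable (fun ω => ∫ u in Ioo 0 t, C.waiting (stateAt a ω u)) C.prob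
  simpa using (integrableOn_stateAt_mul C.waiting a (s := Ioo 0 t) (f := 1)
    (integrableOn_const measure_Ioo_lt_top.ne)).integral_prod_left

theorem W_eq_accrual : W (C := C) = accrual C.waiting := by
  ext a t
  simpa [W, waitingTime, accrual] using integral_stateAt_mul C.waiting a (s := Ioo 0 t) (f := 1)
    (integrableOn_const measure_Ioo_lt_top.ne)

theorem laplaceConverges_transition (g : C.State → ℝ) {s : ℂ} (hs : 0 < s.re) :
    LaplaceConverges (transition g a) s :=
  laplaceConverges_of_bounded (measurable_transition g a)
    (exists_norm_transition_le g a).choose_spec hs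

theorem laplaceConverges_accrual (g : C.State → ℝ) (a : C.State) {s : ℂ} (hs : 0 < s.re) :
    LaplaceConverges (accrual g a) s := (laplaceConverges_transition a g hs).primitive hs

end Accrual

section Resolvent

variable {s : ℂ}

theorem integrableOn_transition_mul_exp (hs : 0 < s.re) (h : C.State → ℂ) (a : C.State) :
    IntegrableOn (fun u : ℝ => transition h a u * Complex.exp (-(s * u))) (Ioi 0) :=
  (integrableOn_exp_neg_mul hs).bdd_mul (measurable_transition h a).aestronglyMeasurable
    (Eventually.of_forall (exists_norm_transition_le h a).choose_spec)

variable (C) in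
/-- The generator of the chain, as an operator on functions on the state space. -/
def generator : Module.End ℂ (C.State → ℂ) where
  toFun h := rewardRate fun x e => h (C.next x e) - h x
  map_add' h h' := by
    ext x
    simp only [rewardRate, Pi.add_apply, ← Finset.sum_add_distrib]
    exact Finset.sum_congr rfl fun e _ => by ring
  map_smul' z h := by
    ext x
    simp only [rewardRate, Pi.smul_apply, smul_eq_mul, RingHom.id_apply, Finset.mul_sum]
    exact Finset.sum_congr rfl fun e _ => by ring

variable (C) in
/-- The resolvent `∫₀^∞ e^{-su} P_u du` of the chain; the right half-plane is where the integral
converges, and hence where it is linear. -/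
def resolvent (hs : 0 < s.re) : Module.End ℂ (C.State → ℂ) where
  toFun h a := ∫ u : ℝ in Ioi 0, transition h a u * Complex.exp (-(s * u))
  map_add' h h' := by
    ext a
    have hadd (u : ℝ) : transition (h + h') a u = transition h a u + transition h' a u :=
      integral_add (integrable_comp_stateAt h a u) (integrable_comp_stateAt h' a u)
    simp_rw [hadd, add_mul]
    exact integral_add (integrableOn_transition_mul_exp hs h a)
      (integrableOn_transition_mul_exp hs h' a)
  map_smul' z h := by
    ext a
    have hsmul (u : ℝ) : transition (z • h) a u = z * transition h a u := integral_const_mul _ _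
    simp_rw [hsmul, mul_assoc, integral_const_mul]
    rfl

theorem sum_increment_mul_exp (hs : s ≠ 0) (h : C.State → ℂ) (a : C.State) (ω : C.Sample) (N : ℕ) :
    ∑ n ∈ Finset.range N, (h (chain a ω (n + 1)) - h (chain a ω n)) *
        Complex.exp (-(s * startTime a ω (n + 1))) =
      h (chain a ω N) * Complex.exp (-(s * startTime a ω N)) - h a +
        s * ∑ n ∈ Finset.range N, h (chain a ω n) *
          ∫ u : ℝ in startTime a ω n..startTime a ω (n + 1), Complex.exp (-(s * u)) := by
  induction N with
  | zero => simp [chain, startTime_zero]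
  | succ N ih =>
    rw [Finset.sum_range_succ, ih, Finset.sum_range_succ, mul_add, mul_left_comm s,
      integral_exp_neg_mul_interval hs]
    ring

theorem tendsto_mul_exp_startTime (hs : 0 < s.re) (h : C.State → ℂ) (a : C.State) {ω : C.Sample}
    (htop : Tendsto (startTime a ω) atTop atTop) :
    Tendsto (fun N => h (chain a ω N) * Complex.exp (-(s * startTime a ω N)))
      atTop (𝓝 0) := by
  obtain ⟨M, hM⟩ := exists_norm_le h
  have hdecay : Tendsto (fun N => M * Real.exp (-(s.re * startTime a ω N)))
      atTop (𝓝 0) := by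
    simpa using (Real.tendsto_exp_neg_atTop_nhds_zero.comp
      (htop.const_mul_atTop hs)).const_mul M
  refine squeeze_zero_norm (fun N => ?_) hdecay
  rw [norm_mul, Complex.norm_exp]
  simpa using mul_le_mul_of_nonneg_right (hM (chain a ω N)) (Real.exp_pos _).le

theorem tsum_increment_mul_expKernel (hs : 0 < s.re) (h : C.State → ℂ) (a : C.State)
    {ω : C.Sample} (hmono : StrictMono (startTime a ω))
    (htop : Tendsto (startTime a ω) atTop atTop)
    (hsum : Summable fun n =>
      (h (chain a ω (n + 1)) - h (chain a ω n)) * expKernel s (startTime a ω (n + 1))) :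
    ∑' n, (h (chain a ω (n + 1)) - h (chain a ω n)) * expKernel s (startTime a ω (n + 1)) =
      s * (∫ u in Ioi 0, h (stateAt a ω u) * expKernel s u) - h a := by
  have hs₀ : s ≠ 0 := fun h₀ => by simp [h₀] at hs
  have hpos (n : ℕ) : 0 < startTime a ω (n + 1) := hmono n.succ_pos
  have hnonneg (n : ℕ) : 0 ≤ startTime a ω n := hmono.monotone n.zero_le
  have hintegral := hasSum_mul_integral_startTime h a hmono htop (integrable_expKernel hs)
  simp_rw [fun n => integral_expKernel_interval (s := s) (hnonneg n)
    (hmono.monotone n.le_succ)] at hintegral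
  simp_rw [expKernel_of_pos (hpos _)] at hsum ⊢
  refine tendsto_nhds_unique hsum.hasSum.tendsto_sum_nat ?_
  simp_rw [sum_increment_mul_exp hs₀]
  simpa [sub_eq_add_neg, add_comm] using ((tendsto_mul_exp_startTime hs h a htop).sub_const
    (h a)).add (hintegral.tendsto_sum_nat.const_mul s)

theorem resolvent_generator (hs : 0 < s.re) (h : C.State → ℂ) :
    resolvent C hs (generator C h) = s • resolvent C hs h - h := by
  ext a
  let increment (x : C.State) (e : CallEvent) : ℂ := h (C.next x e) - h x
  have hsummable := ae_summable_norm_of_summable_integral_norm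
    (integrable_event_mul increment a measurable_expKernel (norm_expKernel_le hs))
    (summable_integral_norm_event_mul increment a measurable_expKernel
      (integrable_expKernel hs) (norm_expKernel_le hs))
  have hpath : ∀ᵐ ω ∂C.prob,
      ∑' n, increment (chain a ω n) (event a ω n) * expKernel s (eventTime a ω n) =
        s * (∫ u in Ioi 0, h (stateAt a ω u) * expKernel s u) - h a := by
    filter_upwards [hsummable, ae_strictMono_startTime a, ae_tendsto_startTime a]
      with ω hω hmono htop
    exact tsum_increment_mul_expKernel hs h a hmono htop hω.of_norm
  have hintegrable := (integrableOn_stateAt_mul h a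
    (integrable_expKernel hs).integrableOn (s := Ioi 0)).integral_prod_left
  calc resolvent C hs (generator C h) a
      = ∫ u in Ioi 0, transition (rewardRate increment) a u * expKernel s u :=
        (setIntegral_mul_expKernel _).symm
    _ = ∫ ω, (s * (∫ u in Ioi 0, h (stateAt a ω u) * expKernel s u) - h a) ∂C.prob := by
        rw [← integral_tsum_event_mul increment a measurable_expKernel (integrable_expKernel hs)
          (norm_expKernel_le hs), integral_congr_ae hpath]
    _ = s * resolvent C hs h a - h a := by
        rw [integral_sub (hintegrable.const_mul s) (integrable_const _), integral_const_mul,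
          integral_stateAt_mul h a (integrable_expKernel hs).integrableOn,
          setIntegral_mul_expKernel, integral_const, probReal_univ, one_smul]
        rfl

theorem sub_generator_mul_resolvent (hs : 0 < s.re) :
    (s • 1 - generator C) * resolvent C hs = 1 := by
  refine mul_eq_one_comm.1 (LinearMap.ext fun h => ?_)
  simp [resolvent_generator]

theorem laplace_transition (hs : 0 < s.re) (g : C.State → ℝ) (a : C.State) :
    laplace (transition g a) s = resolvent C hs (fun x => (g x : ℂ)) a := by
  have hcast (u : ℝ) : ((transition g a u : ℝ) : ℂ) = transition (fun x => (g x : ℂ)) a u :=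
    integral_complex_ofReal.symm
  simp_rw [laplace, hcast, mul_comm (Complex.exp _)]
  rfl

theorem totalRate_add_mul_laplace_accrual (hs : 0 < s.re) (g : C.State → ℝ) (x : C.State) :
    (C.totalRate x + s) * laplace (accrual g x) s =
      (g x : ℂ) / s + ∑ e, (C.rate x e : ℂ) * laplace (accrual g (C.next x e)) s := by
  have hlaplace (y : C.State) :
      laplace (accrual g y) s = resolvent C hs (fun x => (g x : ℂ)) y / s := by
    rw [← laplace_transition]
    exact laplace_primitive (laplaceConverges_transition y g hs) hs
  have hresolvent := congrFun
    (LinearMap.congr_fun (sub_generator_mul_resolvent (C := C) hs) fun x => (g x : ℂ)) x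
  simp only [Module.End.mul_apply, LinearMap.sub_apply, LinearMap.smul_apply,
    Module.End.one_apply, Pi.sub_apply, Pi.smul_apply, smul_eq_mul, generator, LinearMap.coe_mk,
    AddHom.coe_mk, rewardRate, mul_sub, Finset.sum_sub_distrib, ← Finset.sum_mul] at hresolvent
  simp_rw [hlaplace, mul_div_assoc', ← Finset.sum_div, totalRate, Complex.ofReal_sum]
  rw [← add_div]
  congr 1
  simp only [RCLike.ofReal_eq_complex_ofReal] at hresolvent
  linear_combination hresolvent

end Resolvent

section Totals

theorem sum_callEvent {M : Type*} [AddCommMonoid M] (f : CallEvent → M) :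
    ∑ e, f e = f .arrival + (f .service + f .abandonment) := by
  change ∑ e ∈ ({.arrival, .service, .abandonment} : Finset CallEvent), f e = _
  rw [Finset.sum_insert (by decide), Finset.sum_insert (by decide), Finset.sum_singleton]

theorem rewardRate_eventCost (β γ : ℝ) (x : C.State) :
    rewardRate (eventCost β γ) x =
      C.waiting x * C.theta * γ + C.lam * β * (if (x : ℕ) = C.ℓ then 1 else 0) := by
  rw [rewardRate, sum_callEvent]
  simp only [rate, eventCost, RCLike.ofReal_real_eq_id, id]
  split_ifs <;> ring

theorem rewardRate_serviceCount (x : C.State) :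
    rewardRate (𝕜 := ℝ) serviceCount x = C.busy x * C.mu := by
  rw [rewardRate, sum_callEvent]
  simp [rate, serviceCount]

theorem A_eq_accrual (β γ : ℝ) : A (C := C) β γ = accrual (rewardRate (eventCost β γ)) :=
  funext₂ fun a t => integral_eventSum a (eventCost β γ) t

theorem S_eq_accrual : S (C := C) = accrual (rewardRate serviceCount) :=
  funext₂ fun a t => integral_eventSum a serviceCount t

theorem A_zero_eq_mul_W (γ : ℝ) (a : C.State) (t : ℝ) : A 0 γ a t = C.theta * γ * W a t := by
  rw [A_eq_accrual, W_eq_accrual, ← accrual_const_mul]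
  congr 1 with x
  rw [rewardRate_eventCost]
  ring

end Totals

section LinearSystem

variable (f : C.State → ℝ → ℝ) (s : ℂ) (x : C.State)

theorem laplaceExt_coe : laplaceExt f ((x : ℕ) : ℤ) s = laplace (f x) s := by
  have := x.isLt
  rw [laplaceExt, dif_pos ⟨by omega, by omega⟩]
  rfl

theorem laplaceExt_const_mul (c : ℝ) (a : ℤ) :
    laplaceExt (fun x t => c * f x t) a s = c * laplaceExt f a s := by
  unfold laplaceExt
  split_ifs
  · exact laplace_const_mul c
  · rw [mul_zero]

theorem rate_arrival_mul_laplace_sub :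
    (C.lam : ℂ) * (laplace (f (C.next x .arrival)) s - laplaceExt f (x : ℕ) s) =
      (C.lam : ℂ) * (laplaceExt f ((x : ℕ) + 1) s - laplaceExt f (x : ℕ) s) *
        (if ((x : ℕ) : ℤ) < (C.ℓ : ℤ) then 1 else 0) := by
  by_cases hx : (x : ℕ) < C.ℓ
  · rw [← laplaceExt_coe f s (C.next x .arrival), next, dif_pos hx,
      if_pos (Nat.cast_lt.2 hx), mul_one, Nat.cast_succ]
  · rw [next, dif_neg hx, if_neg (by simpa using hx), laplaceExt_coe, sub_self, mul_zero, mul_zero]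

theorem departureRate_mul_laplaceExt_pred :
    ((C.busy x * C.mu + C.waiting x * C.theta : ℝ) : ℂ) * laplaceExt f ((x : ℕ) - 1) s =
      ((C.busy x * C.mu + C.waiting x * C.theta : ℝ) : ℂ) *
        laplace (f (C.next x .service)) s := by
  by_cases hx : (x : ℕ) = 0
  · simp [busy, waiting, hx]
  · rw [← laplaceExt_coe f s (C.next x .service), next, Nat.cast_pred (Nat.pos_of_ne_zero hx)]

theorem laplaceExt_accrual_eq_div (hs : 0 < s.re) (g : C.State → ℝ) :
    laplaceExt (accrual g) (x : ℕ) s =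
      ((C.lam : ℂ) * laplaceExt (accrual g) ((x : ℕ) + 1) s
            * (if ((x : ℕ) : ℤ) < (C.ℓ : ℤ) then 1 else 0)
          + ((C.busy x * C.mu + C.waiting x * C.theta : ℝ) : ℂ)
            * laplaceExt (accrual g) ((x : ℕ) - 1) s
          + g x / s)
        / (((C.lam * (if ((x : ℕ) : ℤ) < (C.ℓ : ℤ) then 1 else 0)
              + C.busy x * C.mu + C.waiting x * C.theta : ℝ) : ℂ) + s) := by
  have harrival : 0 ≤ C.lam * (if ((x : ℕ) : ℤ) < (C.ℓ : ℤ) then (1 : ℝ) else 0) :=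
    mul_nonneg C.lam_pos.le (by split_ifs <;> simp)
  have hservice : 0 ≤ C.busy x * C.mu := C.rate_nonneg x .service
  have habandonment : 0 ≤ C.waiting x * C.theta := C.rate_nonneg x .abandonment
  have hden : ((C.lam * (if ((x : ℕ) : ℤ) < (C.ℓ : ℤ) then 1 else 0)
      + C.busy x * C.mu + C.waiting x * C.theta : ℝ) : ℂ) + s ≠ 0 :=
    Complex.ne_zero_of_re_pos (by rw [Complex.add_re, Complex.ofReal_re]; positivity)
  have hnext : C.next x .abandonment = C.next x .service := rfl
  have h := totalRate_add_mul_laplace_accrual hs g x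
  rw [totalRate, sum_callEvent, sum_callEvent, hnext, ← laplaceExt_coe (accrual g) s x] at h
  rw [eq_div_iff hden, departureRate_mul_laplaceExt_pred]
  simp only [rate] at h
  push_cast [apply_ite Complex.ofReal] at h ⊢
  linear_combination h + rate_arrival_mul_laplace_sub (accrual g) s x

end LinearSystem

end CallCentre

end

theorem mainTheorem1 (C : CallCentre) (β γ : ℝ) :
    -- on almost every path only finitely many events happen in bounded time
    (∀ a : C.State, ∀ t : ℝ, ∀ᵐ ω ∂C.prob, {n : ℕ | CallCentre.eventTime a ω n ≤ t}.Finite) ∧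
    -- the three expectations exist
    (∀ a : C.State, ∀ t : ℝ, 0 < t →
      Integrable (CallCentre.cost β γ a t) C.prob ∧
      Integrable (CallCentre.waitingTime a t) C.prob ∧
      Integrable (CallCentre.services a t) C.prob) ∧
    -- the three Laplace transforms exist
    (∀ a : C.State, ∀ s : ℂ, 0 < s.re →
      CallCentre.LaplaceConverges (CallCentre.A β γ a) s ∧
      CallCentre.LaplaceConverges (CallCentre.W a) s ∧
      CallCentre.LaplaceConverges (CallCentre.S a) s) ∧
    -- the three linear systems
    (∀ a : ℤ, 0 ≤ a → a ≤ (C.ℓ : ℤ) → ∀ s : ℂ, 0 < s.re →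
      CallCentre.laplaceExt (C := C) (CallCentre.A β γ) a s =
        ((C.lam : ℂ) * CallCentre.laplaceExt (C := C) (CallCentre.A β γ) (a + 1) s
              * (if a < (C.ℓ : ℤ) then 1 else 0)
            + ((min (a : ℝ) (C.k : ℝ) * C.mu + max 0 ((a : ℝ) - (C.k : ℝ)) * C.theta : ℝ) : ℂ)
              * CallCentre.laplaceExt (C := C) (CallCentre.A β γ) (a - 1) s
            + ((max 0 ((a : ℝ) - (C.k : ℝ)) * C.theta * γ
                + C.lam * β * (if a = (C.ℓ : ℤ) then 1 else 0) : ℝ) : ℂ) / s)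
          / (((C.lam * (if a < (C.ℓ : ℤ) then 1 else 0)
                + min (a : ℝ) (C.k : ℝ) * C.mu
                + max 0 ((a : ℝ) - (C.k : ℝ)) * C.theta : ℝ) : ℂ) + s) ∧
      CallCentre.laplaceExt (C := C) CallCentre.W a s =
        ((C.lam : ℂ) * CallCentre.laplaceExt (C := C) CallCentre.W (a + 1) s
              * (if a < (C.ℓ : ℤ) then 1 else 0)
            + ((min (a : ℝ) (C.k : ℝ) * C.mu + max 0 ((a : ℝ) - (C.k : ℝ)) * C.theta : ℝ) : ℂ)
              * CallCentre.laplaceExt (C := C) CallCentre.W (a - 1) s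
            + ((max 0 ((a : ℝ) - (C.k : ℝ)) : ℝ) : ℂ) / s)
          / (((C.lam * (if a < (C.ℓ : ℤ) then 1 else 0)
                + min (a : ℝ) (C.k : ℝ) * C.mu
                + max 0 ((a : ℝ) - (C.k : ℝ)) * C.theta : ℝ) : ℂ) + s) ∧
      CallCentre.laplaceExt (C := C) CallCentre.S a s =
        ((C.lam : ℂ) * CallCentre.laplaceExt (C := C) CallCentre.S (a + 1) s
              * (if a < (C.ℓ : ℤ) then 1 else 0)
            + ((min (a : ℝ) (C.k : ℝ) * C.mu + max 0 ((a : ℝ) - (C.k : ℝ)) * C.theta : ℝ) : ℂ)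
              * CallCentre.laplaceExt (C := C) CallCentre.S (a - 1) s
            + ((min (a : ℝ) (C.k : ℝ) * C.mu : ℝ) : ℂ) / s)
          / (((C.lam * (if a < (C.ℓ : ℤ) then 1 else 0)
                + min (a : ℝ) (C.k : ℝ) * C.mu
                + max 0 ((a : ℝ) - (C.k : ℝ)) * C.theta : ℝ) : ℂ) + s)) ∧
    -- without blocking cost, abandonment cost and waiting time are proportional
    (β = 0 →
      (∀ a : C.State, ∀ t : ℝ, 0 < t →
        CallCentre.A β γ a t = C.theta * γ * CallCentre.W a t) ∧
      (∀ a : ℤ, ∀ s : ℂ, 0 < s.re →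
        CallCentre.laplaceExt (C := C) (CallCentre.A β γ) a s =
          (C.theta : ℂ) * (γ : ℂ) * CallCentre.laplaceExt (C := C) CallCentre.W a s)) := by
  refine ⟨CallCentre.ae_finite_eventTime_le, fun a t _ => ⟨CallCentre.integrable_eventSum a _ t,
    CallCentre.integrable_waitingTime a t, CallCentre.integrable_eventSum a _ t⟩,
    fun a s hs => ?_, fun a h₀ hℓ s hs => ?_, ?_⟩
  · rw [CallCentre.A_eq_accrual, CallCentre.W_eq_accrual, CallCentre.S_eq_accrual]
    exact ⟨CallCentre.laplaceConverges_accrual _ a hs,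
      CallCentre.laplaceConverges_accrual _ a hs, CallCentre.laplaceConverges_accrual _ a hs⟩
  · obtain ⟨x, rfl⟩ : ∃ x : C.State, a = (x : ℕ) := ⟨⟨a.toNat, by omega⟩, by simp [h₀]⟩
    rw [CallCentre.A_eq_accrual, CallCentre.W_eq_accrual, CallCentre.S_eq_accrual]
    have hA := CallCentre.laplaceExt_accrual_eq_div s x hs (CallCentre.rewardRate <|
      CallCentre.eventCost β γ)
    have hW := CallCentre.laplaceExt_accrual_eq_div s x hs C.waiting
    have hS := CallCentre.laplaceExt_accrual_eq_div s x hs (CallCentre.rewardRate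
      CallCentre.serviceCount)
    rw [CallCentre.rewardRate_eventCost] at hA
    rw [CallCentre.rewardRate_serviceCount] at hS
    simp only [Int.cast_natCast, Nat.cast_inj]
    exact ⟨hA, hW, hS⟩
  · rintro rfl
    refine ⟨fun a t _ => CallCentre.A_zero_eq_mul_W γ a t, fun a s _ => ?_⟩
    rw [← Complex.ofReal_mul, ← CallCentre.laplaceExt_const_mul]
    congr 1 with x t
    exact CallCentre.A_zero_eq_mul_W γ x t
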